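/- Let $n\ge 2$ and let $B_n$ be Artin's braid group, generated by $\sigma_1,\dots,\sigma_{n-1}$ subject to $\sigma_i\sigma_j=\sigma_j\sigma_i$ for $|i-j|\ge 2$ and $\sigma_i\sigma_{i+1}\sigma_i=\sigma_{i+1}\sigma_i\sigma_{i+1}$ for $1\le i\le n-2$. Let $\pi\colon B_n\to S_n$ be the homomorphism with $\pi(\sigma_i)=(i,i+1)$. A half-twist is an element of $B_n$ of the form $q^{-1}\sigma_1q$ with $q\in B_n$. A combed braid is a braid that can be drawn so that the strings $2,\dots,n$ are parallel and straight; in terms of diagrams, it is represented by a braid word in the letters $\sigma_i^{\pm1}$ in which every crossing involves the string that starts at position $1$, and in which this string also ends at position $1$. The combed braids form a subgroup $A_n$ of $B_n$, which is generated by the elements $a_i=\sigma_1\cdots\sigma_{i-1}\sigma_i^2\sigma_{i-1}^{-1}\cdots\sigma_1^{-1}$, $1\le i\le n-1$. Theorem. Let $b\in B_n$ and $k\in\mathbb Z$. Then $b=h^{2k}$ for some half-twist $h\in B_n$ with $\pi(h)=(1,n)$ if and only if $b$ is a combed braid that is conjugate in $A_n$ to $a_{n-1}^k$, that is, $b=P^{-1}a_{n-1}^kP$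 for some $P\in A_n$. -/

import Mathlib

/-- The defining relators of the braid group on `n` strings. The generators are indexed by
`Fin (n - 1)`; the index `i` (counted from `0`) stands for the generator usually written
`σ_{i+1}`. -/
def braidRels (n : ℕ) : Set (FreeGroup (Fin (n - 1))) :=
  {r | ∃ i j : Fin (n - 1), i.val + 2 ≤ j.val ∧
      r = (FreeGroup.of i * FreeGroup.of j) * (FreeGroup.of j * FreeGroup.of i)⁻¹} ∪
  {r | ∃ i j : Fin (n - 1), i.val + 1 = j.val ∧
      r = (FreeGroup.of i * FreeGroup.of j * FreeGroup.of i) *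
        (FreeGroup.of j * FreeGroup.of i * FreeGroup.of j)⁻¹}

/-- Artin's braid group on `n` strings. -/
abbrev BraidGroup (n : ℕ) : Type := PresentedGroup (braidRels n)

namespace BraidGroup

/-- The Artin generator which interchanges the strings at positions `i` and `i + 1`
(positions are `0, …, n - 1`). -/
def sigma {n : ℕ} (i : Fin (n - 1)) : BraidGroup n := PresentedGroup.of i

/-- The transposition of the positions `i` and `i + 1`. -/
def adjSwap {n : ℕ} (i : Fin (n - 1)) : Equiv.Perm (Fin n) :=
  Equiv.swap ⟨i.val, by omega⟩ ⟨i.val + 1, by omega⟩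

theorem adjSwap_rels {n : ℕ} :
    ∀ r ∈ braidRels n, FreeGroup.lift (adjSwap (n := n)) r = 1 := by
  rintro r (⟨⟨i, hi⟩, ⟨j, hj⟩, hij, rfl⟩ | ⟨⟨i, hi⟩, ⟨j, hj⟩, hij, rfl⟩)
  · simp only [map_mul, map_inv, FreeGroup.lift_apply_of]
    rw [mul_inv_eq_one]
    refine (Equiv.Perm.disjoint_swap_swap ?_).commute
    simp only at hij
    simp
    omega
  · simp only at hij
    subst hij
    simp only [map_mul, map_inv, FreeGroup.lift_apply_of]
    rw [mul_inv_eq_one]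
    have h1 : (⟨i, by omega⟩ : Fin n) ≠ ⟨i + 1, by omega⟩ := by simp
    have h2 : (⟨i, by omega⟩ : Fin n) ≠ ⟨i + 1 + 1, by omega⟩ := by simp; omega
    have h3 : (⟨i + 1, by omega⟩ : Fin n) ≠ ⟨i + 1 + 1, by omega⟩ := by simp
    have key : ∀ x y z : Fin n, x ≠ y → x ≠ z → y ≠ z →
        Equiv.swap x y * Equiv.swap y z * Equiv.swap x y =
          Equiv.swap y z * Equiv.swap x y * Equiv.swap y z := by
      intro x y z hxy hxz hyz
      rw [Equiv.swap_mul_swap_mul_swap hxy hxz, Equiv.swap_comm x y, Equiv.swap_comm y z,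
        Equiv.swap_mul_swap_mul_swap hyz.symm hxz.symm, Equiv.swap_comm]
    exact key _ _ _ h1 h2 h3

/-- The permutation induced by a braid: the homomorphism to the symmetric group that sends
each Artin generator to the transposition of the two adjacent positions. -/
def perm (n : ℕ) : BraidGroup n →* Equiv.Perm (Fin n) :=
  PresentedGroup.toGroup adjSwap_rels

/-- A half-twist is a conjugate of the first Artin generator. -/
def IsHalfTwist {n : ℕ} (hn : 2 ≤ n) (h : BraidGroup n) : Prop :=
  ∃ q : BraidGroup n, h = q⁻¹ * sigma ⟨0, by omega⟩ * q

/-- A braid word, i.e. a braid diagram read from top to bottom: the letter `(i, true)` is the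
crossing `σ` and the letter `(i, false)` the crossing `σ⁻¹` of the strings that are at that
height at the positions `i` and `i + 1`. -/
abbrev Word (n : ℕ) : Type := List (Fin (n - 1) × Bool)

/-- The braid represented by a braid word. -/
def ofWord {n : ℕ} (w : Word n) : BraidGroup n :=
  (w.map fun x => if x.2 then sigma x.1 else (sigma x.1)⁻¹).prod

/-- `OnlyMoves p w q`: in the diagram `w`, the string that starts at position `p` ends at
position `q` and takes part in every crossing of the diagram (over or under, in either
direction). So no two of the other strings cross: up to a planar isotopy they are parallel,
and this one string moves among them. -/
inductive OnlyMoves {n : ℕ} : ℕ → Word n → ℕ → Prop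
  | nil (p : ℕ) : OnlyMoves p [] p
  | right (i : Fin (n - 1)) (e : Bool) (w : Word n) (q : ℕ) (h : OnlyMoves (i.val + 1) w q) :
      OnlyMoves i.val ((i, e) :: w) q
  | left (i : Fin (n - 1)) (e : Bool) (w : Word n) (q : ℕ) (h : OnlyMoves i.val w q) :
      OnlyMoves (i.val + 1) ((i, e) :: w) q

/-- A combed braid: it can be drawn so that all strings but the first are parallel and
straight. That is, it has a diagram in which every crossing involves the first string, and
this string ends where it started (so that every other string also does). -/
def IsCombed {n : ℕ} (b : BraidGroup n) : Prop :=
  ∃ w : Word n, OnlyMoves 0 w 0 ∧ ofWord w = b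

theorem ofWord_append {n : ℕ} (v w : Word n) : ofWord (v ++ w) = ofWord v * ofWord w := by
  simp [ofWord]

theorem OnlyMoves.append {n : ℕ} {p q r : ℕ} {v w : Word n} (hv : OnlyMoves p v q)
    (hw : OnlyMoves q w r) : OnlyMoves p (v ++ w) r := by
  induction hv with
  | nil p => exact hw
  | right i e v q _ ih => exact .right i e _ _ (ih hw)
  | left i e v q _ ih => exact .left i e _ _ (ih hw)

theorem OnlyMoves.exists_inv {n : ℕ} {p q : ℕ} {w : Word n} (hw : OnlyMoves p w q) :
    ∃ v : Word n, OnlyMoves q v p ∧ ofWord v = (ofWord w)⁻¹ := by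
  induction hw with
  | nil p => exact ⟨[], .nil p, by simp [ofWord]⟩
  | right i e w q _ ih =>
    obtain ⟨v, hv, hvw⟩ := ih
    refine ⟨v ++ [(i, !e)], hv.append (.left i _ _ _ (.nil _)), ?_⟩
    rw [ofWord_append, hvw]
    cases e <;> simp [ofWord]
  | left i e w q _ ih =>
    obtain ⟨v, hv, hvw⟩ := ih
    refine ⟨v ++ [(i, !e)], hv.append (.right i _ _ _ (.nil _)), ?_⟩
    rw [ofWord_append, hvw]
    cases e <;> simp [ofWord]

/-- The group of combed braids. -/
def combed (n : ℕ) : Subgroup (BraidGroup n) where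
  carrier := {b | IsCombed b}
  one_mem' := ⟨[], .nil 0, by simp [ofWord]⟩
  mul_mem' := by
    rintro _ _ ⟨v, hv, rfl⟩ ⟨w, hw, rfl⟩
    exact ⟨v ++ w, hv.append hw, ofWord_append v w⟩
  inv_mem' := by
    rintro _ ⟨w, hw, rfl⟩
    exact hw.exists_inv

/-- The product of the first `p` Artin generators, in increasing order. -/
def initialProd (n p : ℕ) : BraidGroup n :=
  (((List.finRange (n - 1)).take p).map sigma).prod

/-- The combed braid in which the first string passes the strings in between, goes once around
the string at position `i + 1`, and comes back the same way: the conjugate of the square of the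
generator with index `i` by the product of all earlier generators. -/
def loop {n : ℕ} (i : Fin (n - 1)) : BraidGroup n :=
  initialProd n i.val * sigma i ^ 2 * (initialProd n i.val)⁻¹

theorem initialProd_succ {n : ℕ} (i : Fin (n - 1)) :
    initialProd n (i.val + 1) = initialProd n i.val * sigma i := by
  simp [initialProd, List.take_add_one]

theorem exists_initialProd {n p : ℕ} (hp : p ≤ n - 1) :
    ∃ w : Word n, OnlyMoves 0 w p ∧ ofWord w = initialProd n p := by
  induction p with
  | zero => exact ⟨[], .nil 0, by simp [ofWord, initialProd]⟩
  | succ p ih =>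
    obtain ⟨w, hw, h⟩ := ih (by omega)
    refine ⟨w ++ [(⟨p, by omega⟩, true)],
      hw.append (.right ⟨p, by omega⟩ true [] (p + 1) (.nil (p + 1))), ?_⟩
    rw [ofWord_append, h, initialProd_succ ⟨p, by omega⟩]
    simp [ofWord]

/-- The group of combed braids is generated by the braids `loop i`. -/
theorem combed_eq_closure (n : ℕ) :
    combed n = Subgroup.closure (Set.range (loop (n := n))) := by
  apply le_antisymm
  · have key : ∀ {p q : ℕ} {w : Word n}, OnlyMoves p w q →
        initialProd n p * ofWord w * (initialProd n q)⁻¹ ∈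
          Subgroup.closure (Set.range (loop (n := n))) := by
      intro p q w hw
      induction hw with
      | nil p => simp [ofWord]
      | right i e w q _ ih =>
        cases e
        · have h := mul_mem (inv_mem (Subgroup.subset_closure ⟨i, rfl⟩ :
            loop i ∈ Subgroup.closure (Set.range (loop (n := n))))) ih
          convert h using 1
          rw [initialProd_succ]
          simp [ofWord, loop]
          group
        · convert ih using 1
          rw [initialProd_succ]
          simp [ofWord, mul_assoc]
      | left i e w q _ ih =>
        cases e
        · convert ih using 1
          rw [initialProd_succ]
          simp [ofWord, mul_assoc]
        · have h := mul_mem (Subgroup.subset_closure ⟨i, rfl⟩ :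
            loop i ∈ Subgroup.closure (Set.range (loop (n := n)))) ih
          convert h using 1
          rw [initialProd_succ]
          simp [ofWord, loop, pow_two, mul_assoc]
    rintro _ ⟨w, hw, rfl⟩
    simpa [initialProd] using key hw
  · rw [Subgroup.closure_le]
    rintro _ ⟨i, rfl⟩
    obtain ⟨w, hw, h⟩ := exists_initialProd (n := n) (p := i.val) (by omega)
    obtain ⟨v, hv, h'⟩ := hw.exists_inv
    refine ⟨w ++ ([(i, true), (i, true)] ++ v),
      hw.append ((OnlyMoves.right i _ _ _ (.left i _ _ _ (.nil _))).append hv), ?_⟩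
    rw [ofWord_append, ofWord_append, h, h', h]
    simp [ofWord, loop, pow_two, mul_assoc]

end BraidGroup

/-! The element $a_{n-1}$ has a square root `loopRoot`, a half-twist $t$ with permutation $(1,n)$.
Combed braids are pure, so a conjugate of $t$ by a combed braid is again such a half-twist; this
gives one direction.

Conversely, let $h=q^{-1}tq$ have permutation $(1,n)$. Then $q$ preserves the pair $\{1,n\}$, and
replacing $q$ by $tq$ if necessary makes it fix both points. A braid fixing position 1 factors as
$bP$ with $b$ a braid on the other strings and $P$ combed (`exists_eq_tail_mul_combed`). Conjugation
by $b$ carries each loop to an $A_n$-conjugate of the loop that $\pi(b)$ dictates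
(`permutesLoops_of_mem_tailBraids`). As $b$ fixes position $n$, $h^2$ is an $A_n$-conjugate of
$t^2=a_{n-1}$. -/

namespace BraidGroup

variable {n : ℕ}

/-! ### Braid relations and conjugation of loops by generators -/

theorem sigma_commute {i j : Fin (n - 1)} (h : i.val + 2 ≤ j.val) :
    Commute (sigma i : BraidGroup n) (sigma j) := by
  have := PresentedGroup.one_of_mem (rels := braidRels n) (Or.inl ⟨i, j, h, rfl⟩)
  rw [map_mul, map_inv, mul_inv_eq_one, map_mul, map_mul] at this
  exact this

theorem sigma_braid {i j : Fin (n - 1)} (h : i.val + 1 = j.val) :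
    (sigma i * sigma j * sigma i : BraidGroup n) = sigma j * sigma i * sigma j := by
  have := PresentedGroup.one_of_mem (rels := braidRels n) (Or.inr ⟨i, j, h, rfl⟩)
  rw [map_mul, map_inv, mul_inv_eq_one, map_mul, map_mul, map_mul, map_mul] at this
  exact this

theorem perm_sigma (i : Fin (n - 1)) : perm n (sigma i) = adjSwap i :=
  PresentedGroup.toGroup.of _

theorem closure_range_sigma :
    Subgroup.closure (Set.range (sigma : Fin (n - 1) → BraidGroup n)) = ⊤ :=
  PresentedGroup.closure_range_of _

theorem initialProd_zero : initialProd n 0 = 1 := by simp [initialProd]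

theorem commute_sigma_initialProd {i : Fin (n - 1)} {p : ℕ} (h : p < i.val) :
    Commute (sigma i) (initialProd n p) := by
  induction p with
  | zero => rw [initialProd_zero]; exact Commute.one_right _
  | succ p ih =>
    rw [initialProd_succ ⟨p, by omega⟩]
    exact (ih (by omega)).mul_right (sigma_commute (by simp only; omega)).symm

/-- A generator moves through a longer initial product with its index lowered by one. -/
theorem sigma_mul_initialProd {i j : Fin (n - 1)} (hij : i.val + 1 = j.val) {p : ℕ}
    (hjp : j.val < p) (hp : p ≤ n - 1) :
    sigma j * initialProd n p = initialProd n p * sigma i := by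
  induction p, hjp using Nat.le_induction with
  | base =>
    rw [Nat.succ_eq_add_one, initialProd_succ j, ← hij, initialProd_succ i]
    have h := (commute_sigma_initialProd (i := j) (p := i.val) (by omega)).eq
    rw [← mul_assoc, ← mul_assoc, h]
    simp only [mul_assoc]
    rw [← mul_assoc (sigma i), sigma_braid hij, mul_assoc]
  | succ p hjp ih =>
    have hp' : p < n - 1 := by omega
    rw [initialProd_succ ⟨p, hp'⟩, ← mul_assoc, ih (by omega), mul_assoc, mul_assoc]
    congr 1
    exact sigma_commute (by simp only; omega)

/-- The braid relation turns $\sigma_j^{-1}\sigma_i\sigma_j$ into $\sigma_i\sigma_j\sigma_i^{-1}$,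
and $\sigma_j$ commutes with the initial product of length $i$. -/
theorem loop_eq_conj {i j : Fin (n - 1)} (hij : i.val + 1 = j.val) :
    (sigma j)⁻¹ * loop i * sigma j = loop j := by
  have hb := sigma_braid hij
  have hst : (sigma j)⁻¹ * sigma i * sigma j = sigma i * sigma j * (sigma i)⁻¹ := by
    rw [eq_mul_inv_iff_mul_eq, mul_assoc, mul_assoc, inv_mul_eq_iff_eq_mul, ← mul_assoc, hb,
      mul_assoc]
  have hc' : (sigma j)⁻¹ * initialProd n i.val = initialProd n i.val * (sigma j)⁻¹ :=
    ((commute_sigma_initialProd (i := j) (p := i.val) (by omega)).inv_left).eq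
  have hc'' : (initialProd n i.val)⁻¹ * sigma j = sigma j * (initialProd n i.val)⁻¹ :=
    ((commute_sigma_initialProd (i := j) (p := i.val) (by omega)).inv_right).eq.symm
  calc (sigma j)⁻¹ * loop i * sigma j
      = ((sigma j)⁻¹ * initialProd n i.val) * sigma i ^ 2 *
          ((initialProd n i.val)⁻¹ * sigma j) := by simp only [loop, mul_assoc]
    _ = initialProd n i.val * ((sigma j)⁻¹ * sigma i * sigma j) ^ 2 *
          (initialProd n i.val)⁻¹ := by rw [hc', hc'']; simp only [pow_two]; group
    _ = loop j := by
      rw [hst, loop, ← hij, initialProd_succ]; simp only [pow_two]; group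

/-- The product is a single loop around both strings that `sigma j` interchanges, namely a conjugate
of $\sigma_i\sigma_j\sigma_j\sigma_i$. Two braid relations slide $\sigma_j$ through it. -/
theorem commute_sigma_loop_mul_loop {i j : Fin (n - 1)} (hij : i.val + 1 = j.val) :
    Commute (sigma j) (loop j * loop i) := by
  have hc := commute_sigma_initialProd (i := j) (p := i.val) (by omega)
  have hb := sigma_braid hij
  have h : loop j * loop i = initialProd n i.val *
      (sigma i * sigma j * (sigma j * sigma i)) * (initialProd n i.val)⁻¹ := by
    rw [loop, loop, ← hij, initialProd_succ]; simp only [pow_two]; group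
  rw [h]
  refine (hc.mul_right ?_).mul_right hc.inv_right
  have h1 : sigma j * (sigma i * sigma j) = sigma i * sigma j * sigma i := by
    rw [hb, mul_assoc]
  have h2 : sigma i * (sigma j * sigma i) = sigma j * sigma i * sigma j := by
    rw [← hb, mul_assoc]
  change sigma j * (sigma i * sigma j * (sigma j * sigma i)) = _
  rw [← mul_assoc, h1, mul_assoc, h2]
  simp only [mul_assoc]

/-- Conjugation by `sigma j` fixes `loop j * loop i` and takes `loop i` to `loop j`, which
determines the image of `loop j`. -/
theorem conj_loop_of_succ {i j : Fin (n - 1)} (hij : i.val + 1 = j.val) :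
    (sigma j)⁻¹ * loop j * sigma j = loop j * loop i * (loop j)⁻¹ := by
  have h := (commute_sigma_loop_mul_loop hij).eq
  rw [eq_mul_inv_iff_mul_eq]
  nth_rewrite 2 [← loop_eq_conj hij]
  rw [show (sigma j)⁻¹ * loop j * sigma j * ((sigma j)⁻¹ * loop i * sigma j) =
    (sigma j)⁻¹ * (loop j * loop i * sigma j) by group, ← h, inv_mul_cancel_left]

theorem commute_sigma_loop {i j : Fin (n - 1)} (hi : 0 < i.val) (h1 : j ≠ i)
    (h2 : j.val + 1 ≠ i.val) : Commute (sigma i) (loop j) := by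
  have h1' : j.val ≠ i.val := fun h => h1 (Fin.ext h)
  rcases lt_or_gt_of_ne h1' with h | h
  · have hc := commute_sigma_initialProd h
    exact (hc.mul_right ((sigma_commute (by omega)).symm.pow_right 2)).mul_right hc.inv_right
  -- Passing through the longer initial product lowers the index of $\sigma_i$ to $i-1$, which is
  -- far from $j$; this needs $i>0$.
  · let l : Fin (n - 1) := ⟨i.val - 1, by omega⟩
    have hl : l.val + 1 = i.val := by simp only [l]; omega
    have hc := sigma_mul_initialProd hl h (by omega)
    have hs : Commute (sigma l : BraidGroup n) (sigma j ^ 2) :=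
      (sigma_commute (by omega)).pow_right 2
    have hi : sigma i = initialProd n j.val * sigma l * (initialProd n j.val)⁻¹ :=
      eq_mul_inv_of_mul_eq hc
    rw [hi, loop]
    exact Commute.conj_iff _ |>.2 hs

/-! ### Action of the braids on the other strings on the loops -/

/-- The position of the string that `loop i` encircles. -/
def strand (i : Fin (n - 1)) : Fin n := ⟨i.val + 1, by omega⟩

theorem adjSwap_strand_self {i j : Fin (n - 1)} (hij : i.val + 1 = j.val) :
    adjSwap j (strand j) = strand i := by
  have : strand i = ⟨j.val, by omega⟩ := Fin.ext hij
  rw [this]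
  exact Equiv.swap_apply_right _ _

theorem adjSwap_strand_succ {i j : Fin (n - 1)} (hij : i.val + 1 = j.val) :
    adjSwap j (strand i) = strand j := by
  have : strand i = ⟨j.val, by omega⟩ := Fin.ext hij
  rw [this]
  exact Equiv.swap_apply_left _ _

theorem adjSwap_strand_of_ne {i j : Fin (n - 1)} (h1 : j ≠ i) (h2 : j.val + 1 ≠ i.val) :
    adjSwap i (strand j) = strand j := by
  refine Equiv.swap_apply_of_ne_of_ne (fun h => h2 (congrArg Fin.val h)) (fun h => h1 ?_)
  have := congrArg Fin.val h
  simp only [strand] at this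
  exact Fin.ext (by omega)

theorem loop_mem_combed (i : Fin (n - 1)) : loop i ∈ combed n := by
  rw [combed_eq_closure]
  exact Subgroup.subset_closure ⟨i, rfl⟩

/-- The braid `b` conjugates every `loop i` to a conjugate, in the group of combed braids, of the
loop around the string that `b` connects with the string at `i + 1`. -/
def PermutesLoops (b : BraidGroup n) : Prop :=
  ∀ i : Fin (n - 1), ∃ j : Fin (n - 1), perm n b (strand j) = strand i ∧
    ∃ Q ∈ combed n, b⁻¹ * loop i * b = Q⁻¹ * loop j * Q

/-- The loops generate the combed braids, so it is enough to look at them. This keeps the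
conjugating elements combed when two such braids are multiplied. -/
theorem PermutesLoops.conj_mem {b : BraidGroup n} (hb : PermutesLoops b) {P : BraidGroup n}
    (hP : P ∈ combed n) : b⁻¹ * P * b ∈ combed n := by
  have h : combed n ≤ (combed n).comap (MulAut.conj b⁻¹).toMonoidHom := by
    conv_lhs => rw [combed_eq_closure]
    rw [Subgroup.closure_le]
    rintro _ ⟨i, rfl⟩
    obtain ⟨j, -, Q, hQ, h⟩ := hb i
    have h' : b⁻¹ * loop i * b ∈ combed n :=
      h ▸ mul_mem (mul_mem (inv_mem hQ) (loop_mem_combed j)) hQ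
    simpa using h'
  simpa using h hP

theorem PermutesLoops.one : PermutesLoops (1 : BraidGroup n) :=
  fun i => ⟨i, by simp, 1, one_mem _, by simp⟩

theorem PermutesLoops.mul {b c : BraidGroup n} (hb : PermutesLoops b) (hc : PermutesLoops c) :
    PermutesLoops (b * c) := by
  intro i
  obtain ⟨j, hj, Q, hQ, hQi⟩ := hb i
  obtain ⟨l, hl, R, hR, hRj⟩ := hc j
  refine ⟨l, by simp [hl, hj], R * (c⁻¹ * Q * c), mul_mem hR (hc.conj_mem hQ), ?_⟩
  calc (b * c)⁻¹ * loop i * (b * c) = c⁻¹ * (b⁻¹ * loop i * b) * c := by group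
    _ = (c⁻¹ * Q * c)⁻¹ * (c⁻¹ * loop j * c) * (c⁻¹ * Q * c) := by rw [hQi]; group
    _ = _ := by rw [hRj]; group

theorem permutesLoops_sigma {j : Fin (n - 1)} (hj : 0 < j.val) :
    PermutesLoops (sigma j : BraidGroup n) := by
  obtain ⟨l, hl⟩ : ∃ l : Fin (n - 1), l.val + 1 = j.val :=
    ⟨⟨j.val - 1, by omega⟩, by simp only; omega⟩
  intro i
  simp only [perm_sigma]
  by_cases h1 : i = j
  · subst h1
    exact ⟨l, adjSwap_strand_succ hl, (loop i)⁻¹, inv_mem (loop_mem_combed i), by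
      rw [conj_loop_of_succ hl, inv_inv]⟩
  by_cases h2 : i.val + 1 = j.val
  · exact ⟨j, adjSwap_strand_self h2, 1, one_mem _, by simp [loop_eq_conj h2]⟩
  · refine ⟨i, adjSwap_strand_of_ne h1 h2, 1, one_mem _, ?_⟩
    rw [mul_assoc, ← (commute_sigma_loop hj h1 h2).eq]
    simp

/-- Inverting `PermutesLoops` formally would require that conjugation by the inverse also preserves
the combed braids, so the formulas for `sigma j` are solved by hand. -/
theorem permutesLoops_sigma_inv {j : Fin (n - 1)} (hj : 0 < j.val) :
    PermutesLoops (sigma j : BraidGroup n)⁻¹ := by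
  obtain ⟨l, hl⟩ : ∃ l : Fin (n - 1), l.val + 1 = j.val :=
    ⟨⟨j.val - 1, by omega⟩, by simp only; omega⟩
  have hinv : (adjSwap j)⁻¹ = adjSwap j := Equiv.swap_inv _ _
  have hlj := loop_eq_conj hl
  have hjj := conj_loop_of_succ hl
  intro i
  simp only [map_inv, perm_sigma, hinv, inv_inv]
  by_cases h1 : i = j
  · subst h1
    refine ⟨l, adjSwap_strand_succ hl, 1, one_mem _, ?_⟩
    rw [← hlj]; group
  by_cases h2 : i.val + 1 = j.val
  · obtain rfl : i = l := Fin.ext (by omega)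
    refine ⟨j, adjSwap_strand_self h2, loop i, loop_mem_combed i, ?_⟩
    have h3 : loop j = sigma j * (loop j * loop i * (loop j)⁻¹) * (sigma j)⁻¹ := by
      rw [← hjj]; group
    have h4 : sigma j * loop j * (sigma j)⁻¹ = loop i := by rw [← hlj]; group
    -- Solving this for the middle factor exhibits it as the conjugate of `loop j` by `loop i`.
    have h5 : loop j = loop i * (sigma j * loop i * (sigma j)⁻¹) * (loop i)⁻¹ := by
      refine h3.trans ?_
      nth_rewrite 2 [← h4]
      nth_rewrite 3 [← h4]
      group
    rw [h5]; group
  · refine ⟨i, adjSwap_strand_of_ne h1 h2, 1, one_mem _, ?_⟩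
    rw [(commute_sigma_loop hj h1 h2).eq]
    simp

/-- The braids on all strings but the first. -/
def tailBraids (n : ℕ) : Subgroup (BraidGroup n) :=
  Subgroup.closure (sigma '' {i | 0 < i.val})

theorem sigma_mem_tailBraids {i : Fin (n - 1)} (hi : 0 < i.val) : sigma i ∈ tailBraids n :=
  Subgroup.subset_closure ⟨i, hi, rfl⟩

theorem permutesLoops_of_mem_tailBraids {b : BraidGroup n} (hb : b ∈ tailBraids n) :
    PermutesLoops b := by
  induction hb using Subgroup.closure_induction'' with
  | mem x hx => obtain ⟨i, hi, rfl⟩ := hx; exact permutesLoops_sigma hi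
  | inv_mem x hx => obtain ⟨i, hi, rfl⟩ := hx; exact permutesLoops_sigma_inv hi
  | one => exact .one
  | mul x y _ _ hx hy => exact hx.mul hy

/-! ### Coset decomposition by the end position of the first string -/

theorem perm_of_mem_combed {P : BraidGroup n} (hP : P ∈ combed n) : perm n P = 1 := by
  have h : combed n ≤ (perm n).ker := by
    rw [combed_eq_closure, Subgroup.closure_le]
    rintro _ ⟨i, rfl⟩
    simp [MonoidHom.mem_ker, loop, perm_sigma, adjSwap, pow_two]
  exact h hP

theorem perm_apply_zero_of_mem_tailBraids (hn : 0 < n) {b : BraidGroup n}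
    (hb : b ∈ tailBraids n) : perm n b ⟨0, hn⟩ = ⟨0, hn⟩ := by
  have h : tailBraids n ≤
      (MulAction.stabilizer (Equiv.Perm (Fin n)) (⟨0, hn⟩ : Fin n)).comap (perm n) := by
    rw [tailBraids, Subgroup.closure_le]
    rintro _ ⟨i, hi, rfl⟩
    have hi : 0 < i.val := hi
    simp only [Subgroup.coe_comap, Set.mem_preimage, SetLike.mem_coe,
      MulAction.mem_stabilizer_iff, perm_sigma, Equiv.Perm.smul_def]
    refine Equiv.swap_apply_of_ne_of_ne ?_ ?_ <;> (simp [Fin.ext_iff]; try omega)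
  exact h hb

/-- Permutations compose as functions, so `perm` sends the position where a string ends to the one
where it starts. These values tell the cosets apart. -/
theorem perm_initialProd_apply {p : ℕ} (hp : p < n) :
    perm n (initialProd n p) ⟨p, hp⟩ = ⟨0, by omega⟩ := by
  induction p with
  | zero => simp [initialProd_zero]
  | succ p ih =>
    rw [initialProd_succ ⟨p, by omega⟩, map_mul, Equiv.Perm.mul_apply, perm_sigma]
    have : adjSwap (n := n) ⟨p, by omega⟩ ⟨p + 1, hp⟩ = ⟨p, by omega⟩ :=
      Equiv.swap_apply_right _ _
    rw [this, ih]

/-- Right multiplication by a generator permutes the cosets represented by the initial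
products. -/
theorem exists_initialProd_mul_sigma (i : Fin (n - 1)) {p : ℕ} (hp : p ≤ n - 1) (e : Bool) :
    ∃ b ∈ tailBraids n, ∃ P ∈ combed n, ∃ r ≤ n - 1,
      initialProd n p * (if e then sigma i else (sigma i)⁻¹) = b * P * initialProd n r := by
  rcases lt_trichotomy p i.val with h | rfl | h
  · have hc := commute_sigma_initialProd h
    refine ⟨if e then sigma i else (sigma i)⁻¹, ?_, 1, one_mem _, p, hp, ?_⟩
    · have := sigma_mem_tailBraids (i := i) (by omega)
      cases e
      · exact inv_mem this
      · exact this
    · cases e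
      · simpa using hc.inv_left.eq.symm
      · simpa using hc.eq.symm
  -- The first string takes part in this crossing: a positive one lengthens the initial product, a
  -- negative one does so at the cost of an inverse loop.
  · refine ⟨1, one_mem _, if e then 1 else (loop i)⁻¹, ?_, i.val + 1, by omega, ?_⟩
    · cases e
      · exact inv_mem (loop_mem_combed i)
      · exact one_mem _
    · rw [initialProd_succ]
      cases e
      · simp only [loop]; simp; group
      · simp
  · obtain h | h := Nat.eq_or_lt_of_le h
    · obtain rfl : i.val + 1 = p := h
      refine ⟨1, one_mem _, if e then loop i else 1, ?_, i.val, by omega, ?_⟩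
      · cases e
        · exact one_mem _
        · exact loop_mem_combed i
      · rw [initialProd_succ]
        cases e
        · simp
        · simp only [loop]; simp [pow_two, mul_assoc]
    -- The first string has already passed this crossing, which therefore reappears on the left with
    -- its index raised by one.
    · let j : Fin (n - 1) := ⟨i.val + 1, by omega⟩
      have hs := sigma_mul_initialProd (i := i) (j := j) rfl h hp
      have hj : sigma j ∈ tailBraids n := sigma_mem_tailBraids (Nat.succ_pos _)
      refine ⟨if e then sigma j else (sigma j)⁻¹, ?_, 1, one_mem _, p, hp, ?_⟩
      · cases e
        · exact inv_mem hj
        · exact hj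
      · cases e
        · simp only [Bool.false_eq_true, if_false, mul_one]
          rw [mul_inv_eq_iff_eq_mul, mul_assoc, ← hs, inv_mul_cancel_left]
        · simpa using hs.symm

/-- Multiplying by one generator at a time preserves the form, because tail braids normalise combed
ones: $bP\cdot cR=(bc)(c^{-1}Pc\,R)$. -/
theorem exists_eq_tail_mul_combed_mul_initialProd (q : BraidGroup n) :
    ∃ b ∈ tailBraids n, ∃ P ∈ combed n, ∃ p ≤ n - 1, q = b * P * initialProd n p := by
  have step : ∀ (q : BraidGroup n) (i : Fin (n - 1)) (e : Bool),
      (∃ b ∈ tailBraids n, ∃ P ∈ combed n, ∃ p ≤ n - 1, q = b * P * initialProd n p) →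
      ∃ b ∈ tailBraids n, ∃ P ∈ combed n, ∃ p ≤ n - 1,
        q * (if e then sigma i else (sigma i)⁻¹) = b * P * initialProd n p := by
    rintro _ i e ⟨b, hb, P, hP, p, hp, rfl⟩
    obtain ⟨c, hc, R, hR, r, hr, h⟩ := exists_initialProd_mul_sigma i hp e
    refine ⟨b * c, mul_mem hb hc, c⁻¹ * P * c * R,
      mul_mem ((permutesLoops_of_mem_tailBraids hc).conj_mem hP) hR, r, hr, ?_⟩
    rw [mul_assoc, h]; group
  have hq : q ∈ Subgroup.closure (Set.range (sigma : Fin (n - 1) → BraidGroup n)) := by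
    rw [closure_range_sigma]; trivial
  induction hq using Subgroup.closure_induction_right with
  | one => exact ⟨1, one_mem _, 1, one_mem _, 0, by omega, by simp [initialProd_zero]⟩
  | mul_right x _ y hy ih => obtain ⟨i, rfl⟩ := hy; simpa using step x i true ih
  | mul_inv_cancel x _ y hy ih => obtain ⟨i, rfl⟩ := hy; simpa using step x i false ih

/-- A braid whose first string ends at the first position is a product of a braid on the other
strings and a combed braid. -/
theorem exists_eq_tail_mul_combed (hn : 0 < n) {q : BraidGroup n}
    (hq : perm n q ⟨0, hn⟩ = ⟨0, hn⟩) :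
    ∃ b ∈ tailBraids n, ∃ P ∈ combed n, q = b * P := by
  obtain ⟨b, hb, P, hP, p, hp, rfl⟩ := exists_eq_tail_mul_combed_mul_initialProd q
  have h : perm n (b * P * initialProd n p) ⟨p, by omega⟩ = ⟨0, hn⟩ := by
    rw [map_mul, Equiv.Perm.mul_apply, perm_initialProd_apply, map_mul, perm_of_mem_combed hP,
      mul_one, perm_apply_zero_of_mem_tailBraids hn hb]
  obtain rfl : p = 0 := congrArg Fin.val ((perm n _).injective (h.trans hq.symm))
  exact ⟨b, hb, P, hP, by simp [initialProd_zero]⟩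

/-! ### Half-twists and their squares -/

theorem isConj_sigma_zero (hn : 2 ≤ n) (i : Fin (n - 1)) :
    IsConj (sigma ⟨0, by omega⟩ : BraidGroup n) (sigma i) := by
  obtain ⟨i, hi⟩ := i
  induction i with
  | zero => exact IsConj.refl _
  | succ i ih =>
    refine (ih (by omega)).trans (isConj_iff.2
      -- By the braid relation, $\sigma_i\sigma_{i+1}$ conjugates $\sigma_i$ to $\sigma_{i+1}$.
      ⟨sigma ⟨i, by omega⟩ * sigma ⟨i + 1, hi⟩, ?_⟩)
    rw [mul_inv_eq_iff_eq_mul, sigma_braid rfl, mul_assoc]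

/-- The half-twist with square `loop i`. -/
def loopRoot (i : Fin (n - 1)) : BraidGroup n :=
  initialProd n i.val * sigma i * (initialProd n i.val)⁻¹

theorem loopRoot_sq (i : Fin (n - 1)) : loopRoot i ^ 2 = loop i := by
  rw [loopRoot, conj_pow, loop]

theorem isConj_loopRoot (hn : 2 ≤ n) (i : Fin (n - 1)) :
    IsConj (sigma ⟨0, by omega⟩ : BraidGroup n) (loopRoot i) :=
  (isConj_sigma_zero hn i).trans (isConj_iff.2 ⟨_, rfl⟩)

theorem perm_loopRoot (i : Fin (n - 1)) :
    perm n (loopRoot i) = Equiv.swap ⟨0, by have := i.isLt; omega⟩ (strand i) := by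
  have h2 : perm n (initialProd n i.val) (strand i) = strand i := by
    have h : ∀ p ≤ i.val, perm n (initialProd n p) (strand i) = strand i := by
      intro p
      induction p with
      | zero => simp [initialProd_zero]
      | succ p ih =>
        intro hp
        rw [initialProd_succ ⟨p, by omega⟩, map_mul, Equiv.Perm.mul_apply, perm_sigma,
          adjSwap_strand_of_ne (by rw [ne_eq, Fin.ext_iff]; simp only; omega)
            (by simp only; omega), ih (by omega)]
    exact h _ le_rfl
  rw [loopRoot, map_mul, map_mul, map_inv, perm_sigma, adjSwap, ← Equiv.swap_apply_apply,
    perm_initialProd_apply]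
  congr 1

theorem isHalfTwist_iff_isConj (hn : 2 ≤ n) {h : BraidGroup n} :
    IsHalfTwist hn h ↔ IsConj (sigma ⟨0, by omega⟩) h := by
  rw [isConj_iff]
  constructor
  · rintro ⟨q, rfl⟩; exact ⟨q⁻¹, by simp⟩
  · rintro ⟨q, rfl⟩; exact ⟨q⁻¹, by simp⟩

/-- A half-twist inducing the transposition of the first string and the string at `i + 1` has a
square that is conjugate to `loop i` in the group of combed braids. -/
theorem IsHalfTwist.exists_sq_eq {hn : 2 ≤ n} {h : BraidGroup n} (hh : IsHalfTwist hn h)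
    (i : Fin (n - 1)) (hperm : perm n h = Equiv.swap ⟨0, by have := i.isLt; omega⟩ (strand i)) :
    ∃ P ∈ combed n, h ^ 2 = P⁻¹ * loop i * P := by
  obtain ⟨c, hc⟩ := isConj_iff.1
    ((isConj_loopRoot hn i).symm.trans ((isHalfTwist_iff_isConj hn).1 hh))
  have hn0 : 0 < n := by omega
  have hne : (⟨0, hn0⟩ : Fin n) ≠ strand i := by simp [strand, Fin.ext_iff]
  have hfix : ∃ q : BraidGroup n, h = q⁻¹ * loopRoot i * q ∧
      perm n q ⟨0, hn0⟩ = ⟨0, hn0⟩ ∧ perm n q (strand i) = strand i := by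
    have hsw : Equiv.swap (perm n c ⟨0, hn0⟩) (perm n c (strand i)) =
        Equiv.swap ⟨0, hn0⟩ (strand i) := by
      rw [← hperm, ← hc, map_mul, map_mul, map_inv, perm_loopRoot, Equiv.swap_apply_apply]
    have himage : Equiv.swap ⟨0, hn0⟩ (strand i) (perm n c ⟨0, hn0⟩) = perm n c (strand i) := by
      rw [← hsw, Equiv.swap_apply_left]
    have hcases : (perm n c ⟨0, hn0⟩ = ⟨0, hn0⟩ ∧ perm n c (strand i) = strand i) ∨
        (perm n c ⟨0, hn0⟩ = strand i ∧ perm n c (strand i) = ⟨0, hn0⟩) := by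
      by_cases h0 : perm n c ⟨0, hn0⟩ = ⟨0, hn0⟩
      · exact Or.inl ⟨h0, by rw [← himage, h0, Equiv.swap_apply_left]⟩
      by_cases hi : perm n c ⟨0, hn0⟩ = strand i
      · exact Or.inr ⟨hi, by rw [← himage, hi, Equiv.swap_apply_right]⟩
      rw [Equiv.swap_apply_of_ne_of_ne h0 hi] at himage
      exact absurd ((perm n c).injective himage) hne
    rcases hcases with ⟨h0, hi⟩ | ⟨h0, hi⟩
    · refine ⟨c⁻¹, by rw [← hc, inv_inv], ?_, ?_⟩
      · rw [map_inv, Equiv.Perm.inv_eq_iff_eq, h0]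
      · rw [map_inv, Equiv.Perm.inv_eq_iff_eq, hi]
    -- The extra factor commutes with `loopRoot i`, so it leaves the conjugate unchanged, and it
    -- undoes the interchange of the two positions.
    · refine ⟨loopRoot i * c⁻¹, by rw [← hc]; group, ?_, ?_⟩
      · rw [map_mul, Equiv.Perm.mul_apply, map_inv, Equiv.Perm.inv_eq_iff_eq.2 hi.symm,
          perm_loopRoot, Equiv.swap_apply_right]
      · rw [map_mul, Equiv.Perm.mul_apply, map_inv, Equiv.Perm.inv_eq_iff_eq.2 h0.symm,
          perm_loopRoot, Equiv.swap_apply_left]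
  obtain ⟨q, rfl, hq0, hqi⟩ := hfix
  obtain ⟨b, hb, P, hP, rfl⟩ := exists_eq_tail_mul_combed hn0 hq0
  obtain ⟨j, hj, Q, hQ, hQj⟩ := permutesLoops_of_mem_tailBraids hb i
  rw [map_mul, perm_of_mem_combed hP, mul_one] at hqi
  -- Both `strand j` and `strand i` are sent to `strand i` by `perm n b`, so the loop comes back to
  -- the same string.
  have hji : strand j = strand i := (perm n b).injective (hj.trans hqi.symm)
  obtain rfl : j = i := Fin.ext (by simpa [strand] using hji)
  refine ⟨Q * P, mul_mem hQ hP, ?_⟩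
  calc ((b * P)⁻¹ * loopRoot j * (b * P)) ^ 2
      = P⁻¹ * (b⁻¹ * loopRoot j ^ 2 * b) * P := by simp only [pow_two]; group
    _ = _ := by rw [loopRoot_sq, hQj]; group

end BraidGroup

theorem theorem3p6 (n : ℕ) (hn : 2 ≤ n) (k : ℤ) (b : BraidGroup n) :
    (∃ h : BraidGroup n, BraidGroup.IsHalfTwist hn h ∧
        BraidGroup.perm n h = Equiv.swap ⟨0, by omega⟩ ⟨n - 1, by omega⟩ ∧
        b = h ^ (2 * k)) ↔
      (BraidGroup.IsCombed b ∧
        ∃ P ∈ BraidGroup.combed n, b = P⁻¹ * BraidGroup.loop ⟨n - 2, by omega⟩ ^ k * P) := by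
  have hstrand : (⟨n - 1, by omega⟩ : Fin n) = BraidGroup.strand ⟨n - 2, by omega⟩ :=
    Fin.ext (by simp only [BraidGroup.strand]; omega)
  rw [hstrand]
  constructor
  · rintro ⟨h, hh, hperm, rfl⟩
    obtain ⟨P, hP, hsq⟩ := hh.exists_sq_eq _ hperm
    have heq : h ^ (2 * k) = P⁻¹ * BraidGroup.loop ⟨n - 2, by omega⟩ ^ k * P := by
      rw [zpow_mul, zpow_ofNat, hsq]
      simpa using conj_zpow (i := k) (a := P⁻¹) (b := BraidGroup.loop ⟨n - 2, by omega⟩)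
    refine ⟨?_, P, hP, heq⟩
    rw [heq]
    exact mul_mem (mul_mem (inv_mem hP) (zpow_mem (BraidGroup.loop_mem_combed _) k)) hP
  · rintro ⟨-, P, hP, rfl⟩
    -- Conjugating the square root of the loop by the same `P` gives the half-twist; `P` is pure, so
    -- the transposition is unchanged.
    refine ⟨P⁻¹ * BraidGroup.loopRoot ⟨n - 2, by omega⟩ * P, ?_, ?_, ?_⟩
    · exact (BraidGroup.isHalfTwist_iff_isConj hn).2
        ((BraidGroup.isConj_loopRoot hn ⟨n - 2, by omega⟩).trans (isConj_iff.2 ⟨P⁻¹, by simp⟩))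
    · rw [map_mul, map_mul, map_inv, BraidGroup.perm_of_mem_combed hP, inv_one, one_mul, mul_one,
        BraidGroup.perm_loopRoot]
    · rw [← BraidGroup.loopRoot_sq, ← zpow_natCast, ← zpow_mul]
      generalize BraidGroup.loopRoot (n := n) ⟨n - 2, by omega⟩ = t
      simpa using (conj_zpow (i := 2 * k) (a := P⁻¹) (b := t)).symm
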